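/- Let $\mathscr H$ be a complex Hilbert space and let $\mathbb B(\mathscr H)$ be the algebra of bounded linear operators on $\mathscr H$, with the order $X\le Y$ iff $Y-X$ is positive; an operator is strictly positive if it is positive and invertible. A continuous function $f:J\to\mathbb R$ on an interval $J\subseteq\mathbb R$ is called operator convex if $f(\lambda X+(1-\lambda)Y)\le\lambda f(X)+(1-\lambda)f(Y)$ for all $\lambda\in[0,1]$ and all bounded self-adjoint operators $X,Y$ on an arbitrary complex Hilbert space with spectra contained in $J$. For $L$ self-adjoint and $R$ strictly positive such that the spectrum of $R^{-1/2}LR^{-1/2}$ is contained in $J$, the perspective of $f$ is $$g(L,R)=R^{1/2}f\left(R^{-1/2}LR^{-1/2}\right)R^{1/2}.$$ Let $T$ be a locally compact Hausdorff space with a nonzero bounded Radon measure $\mu$. Let $f:J\to\mathbb R$ be operator convex, and let $(A_t)_{t\in T}$ and $(B_t)_{t\in T}$ be norm continuous fields in $\mathbb B(\mathscr H)$ such that every $A_t$ is self-adjoint, every $B_t$ is strictly positive, and the spectrum of $B_t^{-1/2}A_tB_t^{-1/2}$ is contained in $J$ for every $t\in T$. Assume that the functions $t\mapsto A_t$, $t\mapsto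 B_t$ and $t\mapsto g(A_t,B_t)$ are Bochner integrable with respect to $\mu$, and put $A=\int_TA_t\,d\mu(t)$ and $B=\int_TB_t\,d\mu(t)$. Then $A$ is self-adjoint, $B$ is strictly positive, the spectrum of $B^{-1/2}AB^{-1/2}$ is contained in $J$ (so that $g(A,B)$ is defined), and $$g(A,B)\le\Theta(\widetilde A,\widetilde B):=\int_TB_t^{1/2}f\left(B_t^{-1/2}A_tB_t^{-1/2}\right)B_t^{1/2}\,d\mu(t).$$ -/

import Mathlib

open MeasureTheory

universe u v

noncomputable section

/-- A real function `f` is operator convex on the real interval `J`: it is continuous on `J` and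
`f (c X + (1 - c) Y) ≤ c f(X) + (1 - c) f(Y)` for all bounded self-adjoint operators `X`, `Y`, on any
complex Hilbert space, whose spectra are contained in `J`, and all `c ∈ [0, 1]`.
The operators `f(X)` are given by the continuous functional calculus, and `≤` is the Loewner order. -/
structure OperatorConvexOn (J : Set ℝ) (f : ℝ → ℝ) : Prop where
  ordConnected : J.OrdConnected
  continuousOn : ContinuousOn f J
  cfc_le : ∀ (H : Type u) [NormedAddCommGroup H] [InnerProductSpace ℂ H] [CompleteSpace H]
    (X Y : H →L[ℂ] H), IsSelfAdjoint X → IsSelfAdjoint Y →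
    spectrum ℝ X ⊆ J → spectrum ℝ Y ⊆ J → ∀ c ∈ Set.Icc (0 : ℝ) 1,
      cfc f (c • X + (1 - c) • Y) ≤ c • cfc f X + (1 - c) • cfc f Y

variable {H : Type u} [NormedAddCommGroup H] [InnerProductSpace ℂ H] [CompleteSpace H]

/-- `R^{-1/2} L R^{-1/2}`, for `R` strictly positive. -/
def relativeQuotient (L R : H →L[ℂ] H) : H →L[ℂ] H :=
  R ^ (-(1 / 2) : ℝ) * L * R ^ (-(1 / 2) : ℝ)

/-- The perspective `g(L, R) = R^{1/2} f(R^{-1/2} L R^{-1/2}) R^{1/2}` of `f`, for `L` self-adjoint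
and `R` strictly positive. -/
def operatorPerspective (f : ℝ → ℝ) (L R : H →L[ℂ] H) : H →L[ℂ] H :=
  R ^ (1 / 2 : ℝ) * cfc f (relativeQuotient L R) * R ^ (1 / 2 : ℝ)

/-- The non-commutative `f`-divergence functional
`Θ(A, B) = ∫ B_t^{1/2} f(B_t^{-1/2} A_t B_t^{-1/2}) B_t^{1/2} dμ(t)` (a Bochner integral). -/
def operatorDivergence {T : Type v} [MeasurableSpace T] (μ : Measure T) (f : ℝ → ℝ)
    (A B : T → H →L[ℂ] H) : H →L[ℂ] H :=
  ∫ t, (B t) ^ (1 / 2 : ℝ) * cfc f (relativeQuotient (A t) (B t)) * (B t) ^ (1 / 2 : ℝ) ∂μ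

end

/-!
The inequality is Jensen's inequality for the perspective `g(L, R) = R^{1/2} f(R^{-1/2} L R^{-1/2})
R^{1/2}`, and it rests on two facts: `g` is jointly sublinear, and `g` is norm continuous on the set of
pairs where it is defined.

Sublinearity comes from the Hansen–Pedersen inequality `f(V† X V) ≤ V† f(X) V` for an isometry `V`
(`OperatorConvexOn.cfc_adjoint_comp_comp_le`), which is operator convexity applied to `X` and its
conjugate by the symmetry `2 V V† - 1`. For `V` with components `C₁`, `C₂` into `H ⊕ H` it reads
`f(C₁† X₁ C₁ + C₂† X₂ C₂) ≤ C₁† f(X₁) C₁ + C₂† f(X₂) C₂` whenever `C₁† C₁ + C₂† C₂ = 1`. For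
`R = a R₁ + b R₂`, `C₁ = √a R₁^{1/2} R^{-1/2}` and `C₂ = √b R₂^{1/2} R^{-1/2}`, conjugation by `R^{1/2}`
turns this into `g(a L₁ + b L₂, a R₁ + b R₂) ≤ a g(L₁, R₁) + b g(L₂, R₂)`
(`OperatorConvexOn.operatorPerspective_smul_add_smul_le`). Every identity between values of the
functional calculus on different spaces follows from one intertwining principle,
`cfc_comp_eq_comp_cfc`.

The epigraph of `g` is therefore convex, so the mean of the field `((A_t, B_t), g(A_t, B_t))` lies in
its closure. The domain of `g` is not closed, but the integrals stay in it: the spectral condition on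
`(L, R)` says that `L - x R`, resp. `x R - L`, is strictly positive for every `x` below, resp. above,
the interval `J` (`spectrum_relativeQuotient_subset_iff`), and the integral of a continuous field of
strictly positive operators is strictly positive (`isStrictlyPositive_integral`). Continuity of `g`
at the mean then gives the inequality for the mean, and homogeneity gives it for the integral.
-/

section

open ContinuousLinearMap Filter Topology

/-! ### Spectra in an interval and strict positivity -/

section
variable {A : Type*} [CStarAlgebra A] [PartialOrder A] [StarOrderedRing A]

/-- Replaces a spectral inclusion in an interval, closed or not, by strict operator inequalities. The
quantifiers over all points below and above `J` also cover unbounded, open and empty `J`. -/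
lemma spectrum_subset_iff_isStrictlyPositive {J : Set ℝ} (hJ : J.OrdConnected) {X : A}
    (hX : IsSelfAdjoint X) :
    spectrum ℝ X ⊆ J ↔
      (∀ x : ℝ, (∀ j ∈ J, x < j) → IsStrictlyPositive (X - x • 1)) ∧
      (∀ x : ℝ, (∀ j ∈ J, j < x) → IsStrictlyPositive (x • 1 - X)) := by
  have hsub : ∀ x : ℝ, IsSelfAdjoint (X - x • (1 : A)) := fun x =>
    hX.sub ((IsSelfAdjoint.all x).smul (IsSelfAdjoint.one A))
  have hsub' : ∀ x : ℝ, IsSelfAdjoint (x • (1 : A) - X) := fun x =>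
    ((IsSelfAdjoint.all x).smul (IsSelfAdjoint.one A)).sub hX
  constructor
  · intro h
    refine ⟨fun x hx => ?_, fun x hx => ?_⟩
    · rw [StarOrderedRing.isStrictlyPositive_iff_spectrum_pos (R := ℝ) _ (hsub x)]
      intro y hy
      rw [← Algebra.algebraMap_eq_smul_one, ← spectrum.sub_singleton_eq] at hy
      obtain ⟨z, hz, _, rfl, rfl⟩ := hy
      exact sub_pos.2 (hx _ (h hz))
    · rw [StarOrderedRing.isStrictlyPositive_iff_spectrum_pos (R := ℝ) _ (hsub' x)]
      intro y hy
      rw [← Algebra.algebraMap_eq_smul_one, ← spectrum.singleton_sub_eq] at hy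
      obtain ⟨_, rfl, z, hz, rfl⟩ := hy
      exact sub_pos.2 (hx _ (h hz))
  · rintro ⟨h₁, h₂⟩ x hx
    by_contra hxJ
    by_cases hlt : ∀ j ∈ J, x < j
    · rw [spectrum.mem_iff, Algebra.algebraMap_eq_smul_one, ← IsUnit.neg_iff, neg_sub] at hx
      exact hx (h₁ x hlt).isUnit
    · push Not at hlt
      obtain ⟨i, hi, hix⟩ := hlt
      rw [spectrum.mem_iff, Algebra.algebraMap_eq_smul_one] at hx
      refine hx (h₂ x fun j hj => ?_).isUnit
      by_contra! hjx
      exact hxJ (hJ.out hi hj ⟨hix, hjx⟩)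

lemma IsStrictlyPositive.exists_pos_smul_one_le {X : A} (hX : IsStrictlyPositive X) :
    ∃ c : ℝ, 0 < c ∧ c • (1 : A) ≤ X := by
  obtain _ | _ := subsingleton_or_nontrivial A
  · exact ⟨1, one_pos, (Subsingleton.elim _ _).le⟩
  simp_rw [← Algebra.algebraMap_eq_smul_one]
  exact (CFC.exists_pos_algebraMap_le_iff hX.isSelfAdjoint).2 fun x hx => hX.spectrum_pos hx

lemma isStrictlyPositive_of_smul_one_le {X : A} {c : ℝ} (hc : 0 < c) (h : c • (1 : A) ≤ X) :
    IsStrictlyPositive X :=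
  (isStrictlyPositive_one.smul hc).of_le h

end

/-! ### Functional calculus and intertwining operators -/

section
variable {H K : Type*} [NormedAddCommGroup H] [InnerProductSpace ℂ H] [CompleteSpace H]
  [NormedAddCommGroup K] [InnerProductSpace ℂ K] [CompleteSpace K]

omit [CompleteSpace H] [CompleteSpace K] in
lemma aeval_comp_eq_comp_aeval {Y : K →L[ℂ] K} {Z : H →L[ℂ] H} {V : H →L[ℂ] K}
    (h : Y ∘L V = V ∘L Z) (p : Polynomial ℝ) :
    Polynomial.aeval Y p ∘L V = V ∘L Polynomial.aeval Z p := by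
  have hpow : ∀ n : ℕ, (Y ^ n) ∘L V = V ∘L (Z ^ n) := by
    intro n
    induction n with
    | zero => ext; simp
    | succ n ih =>
      rw [pow_succ, pow_succ', ContinuousLinearMap.mul_def, ContinuousLinearMap.mul_def,
        comp_assoc, h, ← comp_assoc, ih, comp_assoc, ← ContinuousLinearMap.mul_def,
        ← ContinuousLinearMap.mul_def, ← pow_succ, ← pow_succ']
  induction p using Polynomial.induction_on' with
  | add p q hp hq => simp [add_comp, comp_add, hp, hq]
  | monomial n a =>
    have := hpow n
    ext x
    simpa [Polynomial.aeval_monomial, Algebra.algebraMap_eq_smul_one] using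
      congrArg (fun y => a • y) (DFunLike.congr_fun this x)

lemma norm_cfc_sub_aeval_le {J : Set ℝ} {f : ℝ → ℝ} {p : Polynomial ℝ} {ε : ℝ} (hε : 0 ≤ ε)
    (hp : ∀ x ∈ J, |p.eval x - f x| ≤ ε) (hf : ContinuousOn f J) {X : H →L[ℂ] H}
    (hX : IsSelfAdjoint X) (hXJ : spectrum ℝ X ⊆ J) :
    ‖cfc f X - Polynomial.aeval X p‖ ≤ ε := by
  have hf' := hf.mono hXJ
  rw [← cfc_polynomial p X, ← cfc_sub f p.eval X]
  refine norm_cfc_le hε fun x hx => ?_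
  rw [Real.norm_eq_abs, abs_sub_comm]
  exact hp x (hXJ hx)

/-- Self-adjoint operators intertwined by `V` have their functions intertwined by `V`. By Weierstrass
approximation this reduces to polynomials. -/
lemma cfc_comp_eq_comp_cfc {J : Set ℝ} (hJ : J.OrdConnected) {f : ℝ → ℝ} (hf : ContinuousOn f J)
    {Y : K →L[ℂ] K} {Z : H →L[ℂ] H} {V : H →L[ℂ] K} (hY : IsSelfAdjoint Y) (hZ : IsSelfAdjoint Z)
    (hYJ : spectrum ℝ Y ⊆ J) (hZJ : spectrum ℝ Z ⊆ J) (h : Y ∘L V = V ∘L Z) :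
    cfc f Y ∘L V = V ∘L cfc f Z := by
  obtain hemp | hne := (spectrum ℝ Y ∪ spectrum ℝ Z).eq_empty_or_nonempty
  · -- Only for trivial `H` and `K`: both functions vanish.
    rw [Set.union_empty_iff] at hemp
    rw [cfc_congr (g := fun _ => 0) (a := Y) (by simp [hemp.1]),
      cfc_congr (g := fun _ => 0) (a := Z) (by simp [hemp.2])]
    simp
  have hcomp : IsCompact (spectrum ℝ Y ∪ spectrum ℝ Z) :=
    (ContinuousFunctionalCalculus.isCompact_spectrum Y).union
      (ContinuousFunctionalCalculus.isCompact_spectrum Z)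
  obtain ⟨a, ha, hamin⟩ := hcomp.exists_isLeast hne
  obtain ⟨b, hb, hbmax⟩ := hcomp.exists_isGreatest hne
  have hsub : spectrum ℝ Y ∪ spectrum ℝ Z ⊆ Set.Icc a b := fun x hx => ⟨hamin hx, hbmax hx⟩
  have hcont : ContinuousOn f (Set.Icc a b) :=
    hf.mono (hJ.out (Set.union_subset hYJ hZJ ha) (Set.union_subset hYJ hZJ hb))
  rw [← sub_eq_zero, ← norm_le_zero_iff]
  refine le_of_forall_pos_le_add fun ε hε => ?_
  obtain ⟨p, hp⟩ := exists_polynomial_near_of_continuousOn a b f hcont (ε / (2 * (‖V‖ + 1)))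
    (by positivity)
  have h₁ := norm_cfc_sub_aeval_le (by positivity) (fun x hx => (hp x hx).le) hcont hY
    (Set.subset_union_left.trans hsub)
  have h₂ := norm_cfc_sub_aeval_le (by positivity) (fun x hx => (hp x hx).le) hcont hZ
    (Set.subset_union_right.trans hsub)
  have key : cfc f Y ∘L V - V ∘L cfc f Z =
      (cfc f Y - Polynomial.aeval Y p) ∘L V - V ∘L (cfc f Z - Polynomial.aeval Z p) := by
    rw [sub_comp, comp_sub, aeval_comp_eq_comp_aeval h p]
    abel
  rw [key, zero_add]
  calc _ ≤ ‖cfc f Y - Polynomial.aeval Y p‖ * ‖V‖ + ‖V‖ * ‖cfc f Z - Polynomial.aeval Z p‖ :=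
        (norm_sub_le _ _).trans (add_le_add (opNorm_comp_le _ _) (opNorm_comp_le _ _))
    _ ≤ (ε / (2 * (‖V‖ + 1))) * ‖V‖ + ‖V‖ * (ε / (2 * (‖V‖ + 1))) := by gcongr
    _ = ε * (‖V‖ / (‖V‖ + 1)) := by field_simp; ring
    _ ≤ ε * 1 := by
        gcongr
        rw [div_le_one (by positivity)]
        linarith
    _ = ε := mul_one ε

end

/-! ### Compressions by isometries -/

section
variable {H K : Type*} [NormedAddCommGroup H] [InnerProductSpace ℂ H] [CompleteSpace H]
  [NormedAddCommGroup K] [InnerProductSpace ℂ K] [CompleteSpace K]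

lemma adjoint_comp_comp_le_of_le {X Y : K →L[ℂ] K} (h : X ≤ Y) (V : H →L[ℂ] K) :
    adjoint V ∘L X ∘L V ≤ adjoint V ∘L Y ∘L V := by
  rw [ContinuousLinearMap.le_def] at h ⊢
  simpa [sub_comp, comp_sub] using h.adjoint_conj V

lemma adjoint_comp_smul_one_comp {V : H →L[ℂ] K} (hV : adjoint V ∘L V = 1) (x : ℝ) :
    adjoint V ∘L (x • (1 : K →L[ℂ] K)) ∘L V = x • (1 : H →L[ℂ] H) := by
  rw [smul_comp, comp_smul]
  exact congrArg (x • ·) hV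

lemma IsStrictlyPositive.adjoint_comp_comp {X : K →L[ℂ] K} (hX : IsStrictlyPositive X)
    {V : H →L[ℂ] K} (hV : adjoint V ∘L V = 1) :
    IsStrictlyPositive (adjoint V ∘L X ∘L V) := by
  obtain ⟨c, hc, hcX⟩ := hX.exists_pos_smul_one_le
  refine isStrictlyPositive_of_smul_one_le hc ?_
  rw [← adjoint_comp_smul_one_comp hV]
  exact adjoint_comp_comp_le_of_le hcX V

lemma spectrum_adjoint_comp_comp_subset {J : Set ℝ} (hJ : J.OrdConnected) {X : K →L[ℂ] K}
    (hX : IsSelfAdjoint X) (hXJ : spectrum ℝ X ⊆ J) {V : H →L[ℂ] K} (hV : adjoint V ∘L V = 1) :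
    spectrum ℝ (adjoint V ∘L X ∘L V) ⊆ J := by
  rw [spectrum_subset_iff_isStrictlyPositive hJ (hX.adjoint_conj V)]
  obtain ⟨h₁, h₂⟩ := (spectrum_subset_iff_isStrictlyPositive hJ hX).1 hXJ
  refine ⟨fun x hx => ?_, fun x hx => ?_⟩
  · have := (h₁ x hx).adjoint_comp_comp hV
    rwa [sub_comp, comp_sub, adjoint_comp_smul_one_comp hV] at this
  · have := (h₂ x hx).adjoint_comp_comp hV
    rwa [sub_comp, comp_sub, adjoint_comp_smul_one_comp hV] at this

lemma spectrum_convexCombination_subset {J : Set ℝ} (hJ : J.OrdConnected) {X Y : H →L[ℂ] H}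
    (hX : IsSelfAdjoint X) (hY : IsSelfAdjoint Y) (hXJ : spectrum ℝ X ⊆ J)
    (hYJ : spectrum ℝ Y ⊆ J) {c : ℝ} (hc₀ : 0 < c) (hc₁ : c ≤ 1) :
    spectrum ℝ (c • X + (1 - c) • Y) ⊆ J := by
  have hsa : IsSelfAdjoint (c • X + (1 - c) • Y) :=
    ((IsSelfAdjoint.all c).smul hX).add ((IsSelfAdjoint.all (1 - c)).smul hY)
  rw [spectrum_subset_iff_isStrictlyPositive hJ hsa]
  obtain ⟨h₁, h₂⟩ := (spectrum_subset_iff_isStrictlyPositive hJ hX).1 hXJ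
  obtain ⟨h₃, h₄⟩ := (spectrum_subset_iff_isStrictlyPositive hJ hY).1 hYJ
  refine ⟨fun x hx => ?_, fun x hx => ?_⟩
  · have := ((h₁ x hx).smul hc₀).add_nonneg (smul_nonneg (sub_nonneg.2 hc₁) (h₃ x hx).nonneg)
    convert this using 1
    module
  · have := ((h₂ x hx).smul hc₀).add_nonneg (smul_nonneg (sub_nonneg.2 hc₁) (h₄ x hx).nonneg)
    convert this using 1
    module
end

section
variable {H K : Type u} [NormedAddCommGroup H] [InnerProductSpace ℂ H] [CompleteSpace H]
  [NormedAddCommGroup K] [InnerProductSpace ℂ K] [CompleteSpace K]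

/-- **Jensen's operator inequality** for one isometry `V`. With the symmetry `U = 2 V V† - 1`, the mean
`Y` of `X` and `U X U` commutes with the projection `V V†` and compresses to `V† X V`, so that
`f(V† X V)` is the compression of `f(Y)`, to which operator convexity applies. -/
lemma OperatorConvexOn.cfc_adjoint_comp_comp_le {J : Set ℝ} {f : ℝ → ℝ}
    (hf : OperatorConvexOn.{u} J f) {X : K →L[ℂ] K} (hX : IsSelfAdjoint X)
    (hXJ : spectrum ℝ X ⊆ J) {V : H →L[ℂ] K} (hV : adjoint V ∘L V = 1) :
    cfc f (adjoint V ∘L X ∘L V) ≤ adjoint V ∘L cfc f X ∘L V := by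
  have hVV : ∀ x, adjoint V (V x) = x := fun x => DFunLike.congr_fun hV x
  set U : K →L[ℂ] K := (2 : ℝ) • (V ∘L adjoint V) - 1 with hU
  have hUsa : adjoint U = U := by
    rw [hU, map_sub, ← ContinuousLinearMap.star_eq_adjoint, star_smul,
      ContinuousLinearMap.star_eq_adjoint, adjoint_comp, adjoint_adjoint,
      ← ContinuousLinearMap.star_eq_adjoint, star_one, star_trivial]
  have hUapp : ∀ y, U y = (2 : ℝ) • V (adjoint V y) - y := fun y => by simp [hU]
  have hUV : U ∘L V = V := by
    ext x
    simp [hUapp, hVV, two_smul]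
  have hUU : adjoint U ∘L U = 1 := by
    rw [hUsa]
    ext x
    simp [hUapp, hVV, two_smul]
  set X' : K →L[ℂ] K := adjoint U ∘L X ∘L U with hX'
  have hX'sa : IsSelfAdjoint X' := hX.adjoint_conj U
  have hX'J : spectrum ℝ X' ⊆ J := spectrum_adjoint_comp_comp_subset hf.ordConnected hX hXJ hUU
  set Y : K →L[ℂ] K := (1 / 2 : ℝ) • X + (1 - 1 / 2 : ℝ) • X' with hY
  have hYsa : IsSelfAdjoint Y :=
    ((IsSelfAdjoint.all _).smul hX).add ((IsSelfAdjoint.all _).smul hX'sa)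
  have hYJ : spectrum ℝ Y ⊆ J :=
    spectrum_convexCombination_subset hf.ordConnected hX hX'sa hXJ hX'J (by norm_num) (by norm_num)
  have hle : cfc f Y ≤ (1 / 2 : ℝ) • cfc f X + (1 - 1 / 2 : ℝ) • cfc f X' :=
    hf.cfc_le K X X' hX hX'sa hXJ hX'J (1 / 2) ⟨by norm_num, by norm_num⟩
  -- `X'` is conjugate to `X` by the symmetry `U`
  have hX'U : cfc f X' ∘L U = U ∘L cfc f X := by
    refine cfc_comp_eq_comp_cfc hf.ordConnected hf.continuousOn hX'sa hX hX'J hXJ ?_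
    rw [hX', comp_assoc, comp_assoc]
    nth_rw 2 [← hUsa]
    rw [hUU, hUsa]
    rfl
  have hYV : Y ∘L V = V ∘L (adjoint V ∘L X ∘L V) := by
    ext x
    have : U (V x) = V x := DFunLike.congr_fun hUV x
    simp only [hY, hX', hUsa, add_comp, smul_comp, comp_apply, add_apply, smul_apply, this]
    rw [hUapp]
    module
  have hfY : cfc f Y ∘L V = V ∘L cfc f (adjoint V ∘L X ∘L V) :=
    cfc_comp_eq_comp_cfc hf.ordConnected hf.continuousOn hYsa (hX.adjoint_conj V) hYJ
      (spectrum_adjoint_comp_comp_subset hf.ordConnected hX hXJ hV) hYV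
  have h₁ : adjoint V ∘L cfc f Y ∘L V = cfc f (adjoint V ∘L X ∘L V) := by
    rw [hfY, ← comp_assoc, hV]
    rfl
  have h₂ : adjoint V ∘L cfc f X' ∘L V = adjoint V ∘L cfc f X ∘L V := by
    have : adjoint V ∘L U = adjoint V := by
      have := congrArg adjoint hUV
      rwa [adjoint_comp, hUsa] at this
    calc adjoint V ∘L cfc f X' ∘L V = adjoint V ∘L (cfc f X' ∘L U) ∘L V := by
          rw [comp_assoc (cfc f X'), hUV]
      _ = (adjoint V ∘L U) ∘L cfc f X ∘L V := by
          rw [hX'U]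
          rfl
      _ = adjoint V ∘L cfc f X ∘L V := by rw [this]
  have := adjoint_comp_comp_le_of_le hle V
  rw [h₁, add_comp, comp_add, smul_comp, smul_comp, comp_smul, comp_smul, h₂] at this
  refine this.trans_eq ?_
  module
end

/-! ### Jensen's operator inequality for two operators -/

section

/-- The maps `ι₁ ι₂ : H → K` are isometries with orthogonal ranges that add up to `K`, that is,
they exhibit `K` as the Hilbert sum `H ⊕ H`. -/
structure IsHilbertSumPair {H K : Type*} [NormedAddCommGroup H] [InnerProductSpace ℂ H]
    [CompleteSpace H] [NormedAddCommGroup K] [InnerProductSpace ℂ K] [CompleteSpace K]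
    (ι₁ ι₂ : H →L[ℂ] K) : Prop where
  adjoint_fst_comp_fst : adjoint ι₁ ∘L ι₁ = 1
  adjoint_snd_comp_snd : adjoint ι₂ ∘L ι₂ = 1
  adjoint_fst_comp_snd : adjoint ι₁ ∘L ι₂ = 0
  adjoint_snd_comp_fst : adjoint ι₂ ∘L ι₁ = 0
  add_eq_one : ι₁ ∘L adjoint ι₁ + ι₂ ∘L adjoint ι₂ = 1

lemma exists_isHilbertSumPair (H : Type u) [NormedAddCommGroup H] [InnerProductSpace ℂ H]
    [CompleteSpace H] :
    ∃ ι₁ ι₂ : H →L[ℂ] WithLp 2 (H × H), IsHilbertSumPair ι₁ ι₂ := by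
  let e := (WithLp.prodContinuousLinearEquiv 2 ℂ H H).symm.toContinuousLinearMap
  set ι₁ := e ∘L ContinuousLinearMap.inl ℂ H H with hι₁
  set ι₂ := e ∘L ContinuousLinearMap.inr ℂ H H with hι₂
  have h₁ (x : WithLp 2 (H × H)) : adjoint ι₁ x = x.fst := by
    refine ext_inner_left ℂ fun y => ?_
    rw [adjoint_inner_right]
    simp [hι₁, e, WithLp.prod_inner_apply]
  have h₂ (x : WithLp 2 (H × H)) : adjoint ι₂ x = x.snd := by
    refine ext_inner_left ℂ fun y => ?_
    rw [adjoint_inner_right]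
    simp [hι₂, e, WithLp.prod_inner_apply]
  refine ⟨ι₁, ι₂, ?_, ?_, ?_, ?_, ?_⟩
  · ext x
    rw [comp_apply, h₁]
    simp [hι₁, e]
  · ext x
    rw [comp_apply, h₂]
    simp [hι₂, e]
  · ext x
    rw [comp_apply, h₁]
    simp [hι₂, e]
  · ext x
    rw [comp_apply, h₂]
    simp [hι₁, e]
  · ext x
    rw [add_apply, comp_apply ι₁, comp_apply ι₂, h₁, h₂]
    apply (WithLp.prodContinuousLinearEquiv 2 ℂ H H).injective
    refine Prod.ext ?_ ?_ <;> simp [hι₁, hι₂, e]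

variable {H K : Type*} [NormedAddCommGroup H] [InnerProductSpace ℂ H] [CompleteSpace H]
  [NormedAddCommGroup K] [InnerProductSpace ℂ K] [CompleteSpace K] {ι₁ ι₂ : H →L[ℂ] K}

/-- The operator `X₁ ⊕ X₂` on a Hilbert sum `K = H ⊕ H` with inclusions `ι₁` and `ι₂`. -/
noncomputable def blockDiag (ι₁ ι₂ : H →L[ℂ] K) (X₁ X₂ : H →L[ℂ] H) : K →L[ℂ] K :=
  ι₁ ∘L X₁ ∘L adjoint ι₁ + ι₂ ∘L X₂ ∘L adjoint ι₂

lemma isSelfAdjoint_blockDiag {X₁ X₂ : H →L[ℂ] H} (h₁ : IsSelfAdjoint X₁)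
    (h₂ : IsSelfAdjoint X₂) : IsSelfAdjoint (blockDiag ι₁ ι₂ X₁ X₂) :=
  IsSelfAdjoint.add (h₁.conj_adjoint ι₁) (h₂.conj_adjoint ι₂)

lemma blockDiag_sub (X₁ X₂ Y₁ Y₂ : H →L[ℂ] H) :
    blockDiag ι₁ ι₂ (X₁ - Y₁) (X₂ - Y₂) = blockDiag ι₁ ι₂ X₁ X₂ - blockDiag ι₁ ι₂ Y₁ Y₂ := by
  simp only [blockDiag, sub_comp, comp_sub]
  abel

lemma blockDiag_mono {X₁ X₂ Y₁ Y₂ : H →L[ℂ] H} (h₁ : X₁ ≤ Y₁) (h₂ : X₂ ≤ Y₂) :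
    blockDiag ι₁ ι₂ X₁ X₂ ≤ blockDiag ι₁ ι₂ Y₁ Y₂ := by
  rw [ContinuousLinearMap.le_def] at h₁ h₂ ⊢
  rw [← blockDiag_sub]
  exact IsPositive.add (h₁.conj_adjoint ι₁) (h₂.conj_adjoint ι₂)

namespace IsHilbertSumPair

lemma blockDiag_smul_one (h : IsHilbertSumPair ι₁ ι₂) (x : ℝ) :
    blockDiag ι₁ ι₂ (x • (1 : H →L[ℂ] H)) (x • 1) = x • 1 := by
  rw [← h.add_eq_one]
  ext y
  simp [blockDiag]

lemma isStrictlyPositive_blockDiag (h : IsHilbertSumPair ι₁ ι₂) {X₁ X₂ : H →L[ℂ] H}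
    (h₁ : IsStrictlyPositive X₁) (h₂ : IsStrictlyPositive X₂) :
    IsStrictlyPositive (blockDiag ι₁ ι₂ X₁ X₂) := by
  obtain ⟨c, hc, hcX⟩ := h₁.exists_pos_smul_one_le
  obtain ⟨d, hd, hdX⟩ := h₂.exists_pos_smul_one_le
  refine isStrictlyPositive_of_smul_one_le (lt_min hc hd) ?_
  rw [← h.blockDiag_smul_one]
  exact blockDiag_mono
    ((smul_le_smul_of_nonneg_right (min_le_left c d) zero_le_one).trans hcX)
    ((smul_le_smul_of_nonneg_right (min_le_right c d) zero_le_one).trans hdX)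

lemma spectrum_blockDiag_subset (h : IsHilbertSumPair ι₁ ι₂) {J : Set ℝ} (hJ : J.OrdConnected)
    {X₁ X₂ : H →L[ℂ] H} (h₁ : IsSelfAdjoint X₁) (h₂ : IsSelfAdjoint X₂)
    (hJ₁ : spectrum ℝ X₁ ⊆ J) (hJ₂ : spectrum ℝ X₂ ⊆ J) :
    spectrum ℝ (blockDiag ι₁ ι₂ X₁ X₂) ⊆ J := by
  rw [spectrum_subset_iff_isStrictlyPositive hJ (isSelfAdjoint_blockDiag h₁ h₂)]
  obtain ⟨ha, hb⟩ := (spectrum_subset_iff_isStrictlyPositive hJ h₁).1 hJ₁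
  obtain ⟨hc, hd⟩ := (spectrum_subset_iff_isStrictlyPositive hJ h₂).1 hJ₂
  simp_rw [← h.blockDiag_smul_one, ← blockDiag_sub]
  exact ⟨fun x hx => h.isStrictlyPositive_blockDiag (ha x hx) (hc x hx),
    fun x hx => h.isStrictlyPositive_blockDiag (hb x hx) (hd x hx)⟩

lemma blockDiag_comp_fst (h : IsHilbertSumPair ι₁ ι₂) (X₁ X₂ : H →L[ℂ] H) :
    blockDiag ι₁ ι₂ X₁ X₂ ∘L ι₁ = ι₁ ∘L X₁ := by
  simp only [blockDiag, add_comp, comp_assoc, h.adjoint_fst_comp_fst, h.adjoint_snd_comp_fst,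
    comp_zero, add_zero]
  rfl

lemma blockDiag_comp_snd (h : IsHilbertSumPair ι₁ ι₂) (X₁ X₂ : H →L[ℂ] H) :
    blockDiag ι₁ ι₂ X₁ X₂ ∘L ι₂ = ι₂ ∘L X₂ := by
  simp only [blockDiag, add_comp, comp_assoc, h.adjoint_fst_comp_snd, h.adjoint_snd_comp_snd,
    comp_zero, zero_add]
  rfl

lemma cfc_blockDiag (h : IsHilbertSumPair ι₁ ι₂) {J : Set ℝ} (hJ : J.OrdConnected) {f : ℝ → ℝ}
    (hf : ContinuousOn f J) {X₁ X₂ : H →L[ℂ] H} (h₁ : IsSelfAdjoint X₁) (h₂ : IsSelfAdjoint X₂)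
    (hJ₁ : spectrum ℝ X₁ ⊆ J) (hJ₂ : spectrum ℝ X₂ ⊆ J) :
    cfc f (blockDiag ι₁ ι₂ X₁ X₂) = blockDiag ι₁ ι₂ (cfc f X₁) (cfc f X₂) := by
  have hX := isSelfAdjoint_blockDiag (ι₁ := ι₁) (ι₂ := ι₂) h₁ h₂
  have hXJ := h.spectrum_blockDiag_subset hJ h₁ h₂ hJ₁ hJ₂
  have hl := cfc_comp_eq_comp_cfc hJ hf hX h₁ hXJ hJ₁ (h.blockDiag_comp_fst X₁ X₂)
  have hr := cfc_comp_eq_comp_cfc hJ hf hX h₂ hXJ hJ₂ (h.blockDiag_comp_snd X₁ X₂)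
  calc cfc f (blockDiag ι₁ ι₂ X₁ X₂)
      = cfc f (blockDiag ι₁ ι₂ X₁ X₂) ∘L (1 : K →L[ℂ] K) := rfl
    _ = blockDiag ι₁ ι₂ (cfc f X₁) (cfc f X₂) := by
        rw [← h.add_eq_one, comp_add, ← comp_assoc, ← comp_assoc, hl, hr]
        rfl

lemma adjoint_column_comp_blockDiag_comp (h : IsHilbertSumPair ι₁ ι₂) (X₁ X₂ C₁ C₂ : H →L[ℂ] H) :
    adjoint (ι₁ ∘L C₁ + ι₂ ∘L C₂) ∘L blockDiag ι₁ ι₂ X₁ X₂ ∘L (ι₁ ∘L C₁ + ι₂ ∘L C₂) =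
      star C₁ * X₁ * C₁ + star C₂ * X₂ * C₂ := by
  have e : blockDiag ι₁ ι₂ X₁ X₂ ∘L (ι₁ ∘L C₁ + ι₂ ∘L C₂) =
      ι₁ ∘L (X₁ ∘L C₁) + ι₂ ∘L (X₂ ∘L C₂) := by
    rw [comp_add, ← comp_assoc, ← comp_assoc, h.blockDiag_comp_fst, h.blockDiag_comp_snd]
    rfl
  have h₁₁ := DFunLike.congr_fun h.adjoint_fst_comp_fst
  have h₂₂ := DFunLike.congr_fun h.adjoint_snd_comp_snd
  have h₁₂ := DFunLike.congr_fun h.adjoint_fst_comp_snd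
  have h₂₁ := DFunLike.congr_fun h.adjoint_snd_comp_fst
  simp only [comp_apply] at h₁₁ h₂₂ h₁₂ h₂₁
  rw [e, map_add, adjoint_comp, adjoint_comp]
  ext x
  simp [h₁₁, h₂₂, h₁₂, h₂₁, ContinuousLinearMap.star_eq_adjoint]

end IsHilbertSumPair

/-- **Jensen's operator inequality** for two operators: the case of the isometry `H → H ⊕ H` with
components `C₁`, `C₂` and of the operator `X₁ ⊕ X₂`. -/
lemma OperatorConvexOn.cfc_column_le {H : Type u} [NormedAddCommGroup H] [InnerProductSpace ℂ H]
    [CompleteSpace H] {J : Set ℝ} {f : ℝ → ℝ} (hf : OperatorConvexOn.{u} J f)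
    {X₁ X₂ C₁ C₂ : H →L[ℂ] H} (h₁ : IsSelfAdjoint X₁) (h₂ : IsSelfAdjoint X₂)
    (hJ₁ : spectrum ℝ X₁ ⊆ J) (hJ₂ : spectrum ℝ X₂ ⊆ J)
    (hC : star C₁ * C₁ + star C₂ * C₂ = 1) :
    cfc f (star C₁ * X₁ * C₁ + star C₂ * X₂ * C₂) ≤
      star C₁ * cfc f X₁ * C₁ + star C₂ * cfc f X₂ * C₂ := by
  obtain ⟨ι₁, ι₂, h⟩ := exists_isHilbertSumPair H
  have hV : adjoint (ι₁ ∘L C₁ + ι₂ ∘L C₂) ∘L (ι₁ ∘L C₁ + ι₂ ∘L C₂) = 1 := by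
    have h1 : blockDiag ι₁ ι₂ 1 1 = 1 := h.add_eq_one
    have := h.adjoint_column_comp_blockDiag_comp 1 1 C₁ C₂
    rw [h1, mul_one, mul_one, hC] at this
    exact this
  have := hf.cfc_adjoint_comp_comp_le (isSelfAdjoint_blockDiag h₁ h₂)
    (h.spectrum_blockDiag_subset hf.ordConnected h₁ h₂ hJ₁ hJ₂) hV
  rwa [h.cfc_blockDiag hf.ordConnected hf.continuousOn h₁ h₂ hJ₁ hJ₂,
    h.adjoint_column_comp_blockDiag_comp, h.adjoint_column_comp_blockDiag_comp] at this

end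

/-! ### Joint sublinearity of the perspective -/

section
variable {H : Type u} [NormedAddCommGroup H] [InnerProductSpace ℂ H] [CompleteSpace H]

lemma isSelfAdjoint_relativeQuotient {L R : H →L[ℂ] H} (hL : IsSelfAdjoint L) :
    IsSelfAdjoint (relativeQuotient L R) := by
  have h : IsSelfAdjoint (R ^ (-(1 / 2) : ℝ)) := .of_nonneg CFC.rpow_nonneg
  have := hL.conjugate (R ^ (-(1 / 2) : ℝ))
  rwa [h.star_eq] at this

lemma isStrictlyPositive_rpow_mul_mul_rpow_iff {X R : H →L[ℂ] H} (hR : IsStrictlyPositive R)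
    (s : ℝ) : IsStrictlyPositive (R ^ s * X * R ^ s) ↔ IsStrictlyPositive X :=
  IsUnit.isStrictlyPositive_iff_conjugate_of_isSelfAdjoint X (R ^ s) (hR.rpow R s).isUnit
    (.of_nonneg CFC.rpow_nonneg)

lemma rpow_mul_smul_mul_rpow {R : H →L[ℂ] H} (hR : IsStrictlyPositive R) (x : ℝ) :
    R ^ (-(1 / 2) : ℝ) * (x • R) * R ^ (-(1 / 2) : ℝ) = x • 1 := by
  rw [mul_smul_comm, smul_mul_assoc, CFC.conjugate_rpow_neg_one_half R hR]

/-- The spectrum of `R^{-1/2} L R^{-1/2}` lies in an interval exactly when the corresponding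
operator inequalities between `L` and multiples of `R` hold strictly; these are stable under sums
and integrals. -/
lemma spectrum_relativeQuotient_subset_iff {J : Set ℝ} (hJ : J.OrdConnected) {L R : H →L[ℂ] H}
    (hL : IsSelfAdjoint L) (hR : IsStrictlyPositive R) :
    spectrum ℝ (relativeQuotient L R) ⊆ J ↔
      (∀ x : ℝ, (∀ j ∈ J, x < j) → IsStrictlyPositive (L - x • R)) ∧
      (∀ x : ℝ, (∀ j ∈ J, j < x) → IsStrictlyPositive (x • R - L)) := by
  rw [spectrum_subset_iff_isStrictlyPositive hJ (isSelfAdjoint_relativeQuotient hL)]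
  refine and_congr (forall₂_congr fun x _ => ?_) (forall₂_congr fun x _ => ?_)
  · rw [← isStrictlyPositive_rpow_mul_mul_rpow_iff (X := L - x • R) hR (-(1 / 2)), mul_sub,
      sub_mul, rpow_mul_smul_mul_rpow hR, relativeQuotient]
  · rw [← isStrictlyPositive_rpow_mul_mul_rpow_iff (X := x • R - L) hR (-(1 / 2)), mul_sub,
      sub_mul, rpow_mul_smul_mul_rpow hR, relativeQuotient]

variable (H) in
/-- The pairs `(L, R)` at which the perspective of a function on `J` is defined. -/
def perspectiveDomain (J : Set ℝ) : Set ((H →L[ℂ] H) × (H →L[ℂ] H)) :=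
  {p | IsSelfAdjoint p.1 ∧ IsStrictlyPositive p.2 ∧ spectrum ℝ (relativeQuotient p.1 p.2) ⊆ J}

lemma IsStrictlyPositive.smul_add_smul {X Y : H →L[ℂ] H} (hX : IsStrictlyPositive X)
    (hY : IsStrictlyPositive Y) {a b : ℝ} (ha : 0 ≤ a) (hb : 0 ≤ b) (hab : 0 < a + b) :
    IsStrictlyPositive (a • X + b • Y) := by
  obtain rfl | ha' := ha.eq_or_lt
  · exact (hY.smul (by simpa using hab)).nonneg_add (smul_nonneg le_rfl hX.nonneg)
  · exact (hX.smul ha').add_nonneg (smul_nonneg hb hY.nonneg)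

lemma smul_add_smul_mem_perspectiveDomain {J : Set ℝ} (hJ : J.OrdConnected)
    {p q : (H →L[ℂ] H) × (H →L[ℂ] H)} (hp : p ∈ perspectiveDomain H J)
    (hq : q ∈ perspectiveDomain H J) {a b : ℝ} (ha : 0 ≤ a) (hb : 0 ≤ b) (hab : 0 < a + b) :
    a • p + b • q ∈ perspectiveDomain H J := by
  obtain ⟨hL₁, hR₁, h₁⟩ := hp
  obtain ⟨hL₂, hR₂, h₂⟩ := hq
  have hL : IsSelfAdjoint (a • p.1 + b • q.1) :=
    ((IsSelfAdjoint.all a).smul hL₁).add ((IsSelfAdjoint.all b).smul hL₂)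
  have hR : IsStrictlyPositive (a • p.2 + b • q.2) := hR₁.smul_add_smul hR₂ ha hb hab
  refine ⟨hL, hR, (spectrum_relativeQuotient_subset_iff hJ hL hR).2 ⟨fun x hx => ?_, fun x hx => ?_⟩⟩
  · have := (((spectrum_relativeQuotient_subset_iff hJ hL₁ hR₁).1 h₁).1 x hx).smul_add_smul
      (((spectrum_relativeQuotient_subset_iff hJ hL₂ hR₂).1 h₂).1 x hx) ha hb hab
    convert this using 1
    module
  · have := (((spectrum_relativeQuotient_subset_iff hJ hL₁ hR₁).1 h₁).2 x hx).smul_add_smul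
      (((spectrum_relativeQuotient_subset_iff hJ hL₂ hR₂).1 h₂).2 x hx) ha hb hab
    convert this using 1
    module

lemma rpow_half_mul_rpow_half {R : H →L[ℂ] H} (hR : IsStrictlyPositive R) :
    R ^ (1 / 2 : ℝ) * R ^ (1 / 2 : ℝ) = R := by
  rw [← CFC.rpow_add hR.isUnit]
  norm_num
  exact CFC.rpow_one R hR.nonneg

lemma rpow_half_mul_relativeQuotient_mul_rpow_half {L R : H →L[ℂ] H} (hR : IsStrictlyPositive R) :
    R ^ (1 / 2 : ℝ) * relativeQuotient L R * R ^ (1 / 2 : ℝ) = L := by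
  have h₁ := CFC.rpow_mul_rpow_neg (1 / 2) hR
  have h₂ := CFC.rpow_neg_mul_rpow (1 / 2) hR
  calc _ = (R ^ (1 / 2 : ℝ) * R ^ (-(1 / 2) : ℝ)) * L * (R ^ (-(1 / 2) : ℝ) * R ^ (1 / 2 : ℝ)) := by
        simp only [relativeQuotient, mul_assoc]
    _ = L := by rw [h₁, h₂, one_mul, mul_one]

/-- The perspective of an operator convex function is jointly sublinear. With `b = 0` this contains
its positive homogeneity, with `a + b = 1` its joint convexity. -/
lemma OperatorConvexOn.operatorPerspective_smul_add_smul_le {J : Set ℝ} {f : ℝ → ℝ}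
    (hf : OperatorConvexOn.{u} J f) {p q : (H →L[ℂ] H) × (H →L[ℂ] H)}
    (hp : p ∈ perspectiveDomain H J) (hq : q ∈ perspectiveDomain H J) {a b : ℝ}
    (ha : 0 ≤ a) (hb : 0 ≤ b) (hab : 0 < a + b) :
    operatorPerspective f (a • p.1 + b • q.1) (a • p.2 + b • q.2) ≤
      a • operatorPerspective f p.1 p.2 + b • operatorPerspective f q.1 q.2 := by
  obtain ⟨hL₁, hR₁, h₁⟩ := hp
  obtain ⟨hL₂, hR₂, h₂⟩ := hq
  obtain ⟨L₁, R₁⟩ := p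
  obtain ⟨L₂, R₂⟩ := q
  dsimp only at *
  set R := a • R₁ + b • R₂ with hRdef
  have hR : IsStrictlyPositive R := hR₁.smul_add_smul hR₂ ha hb hab
  set S := R ^ (1 / 2 : ℝ) with hS
  set S' := R ^ (-(1 / 2) : ℝ) with hS'
  have hSS' : S * S' = 1 := CFC.rpow_mul_rpow_neg (1 / 2) hR
  have hS'S : S' * S = 1 := CFC.rpow_neg_mul_rpow (1 / 2) hR
  have hSsa : star S = S := (IsSelfAdjoint.of_nonneg CFC.rpow_nonneg).star_eq
  have hS'sa : star S' = S' := (IsSelfAdjoint.of_nonneg CFC.rpow_nonneg).star_eq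
  have hsa₁ : star (R₁ ^ (1 / 2 : ℝ)) = R₁ ^ (1 / 2 : ℝ) :=
    (IsSelfAdjoint.of_nonneg CFC.rpow_nonneg).star_eq
  have hsa₂ : star (R₂ ^ (1 / 2 : ℝ)) = R₂ ^ (1 / 2 : ℝ) :=
    (IsSelfAdjoint.of_nonneg CFC.rpow_nonneg).star_eq
  -- The columns `√a R₁^{1/2} R^{-1/2}`, `√b R₂^{1/2} R^{-1/2}` form an isometry and compress the two
  -- quotients `R_i^{-1/2} L_i R_i^{-1/2}` to the quotient of the combined pair.
  set C₁ := √a • (R₁ ^ (1 / 2 : ℝ) * S') with hC₁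
  set C₂ := √b • (R₂ ^ (1 / 2 : ℝ) * S') with hC₂
  have e₁ (X : H →L[ℂ] H) :
      star C₁ * X * C₁ = S' * (a • (R₁ ^ (1 / 2 : ℝ) * X * R₁ ^ (1 / 2 : ℝ))) * S' := by
    rw [hC₁, star_smul, star_mul, hsa₁, hS'sa, star_trivial]
    simp only [smul_mul_assoc, mul_smul_comm, smul_smul, Real.mul_self_sqrt ha, mul_assoc]
  have e₂ (X : H →L[ℂ] H) :
      star C₂ * X * C₂ = S' * (b • (R₂ ^ (1 / 2 : ℝ) * X * R₂ ^ (1 / 2 : ℝ))) * S' := by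
    rw [hC₂, star_smul, star_mul, hsa₂, hS'sa, star_trivial]
    simp only [smul_mul_assoc, mul_smul_comm, smul_smul, Real.mul_self_sqrt hb, mul_assoc]
  have hC : star C₁ * C₁ + star C₂ * C₂ = 1 := by
    have := congrArg₂ (· + ·) (e₁ 1) (e₂ 1)
    simp only [mul_one, rpow_half_mul_rpow_half hR₁, rpow_half_mul_rpow_half hR₂] at this
    rw [this, ← add_mul, ← mul_add]
    exact CFC.conjugate_rpow_neg_one_half R hR
  have key := hf.cfc_column_le (isSelfAdjoint_relativeQuotient hL₁)
    (isSelfAdjoint_relativeQuotient hL₂) h₁ h₂ hC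
  rw [e₁, e₂, e₁, e₂, rpow_half_mul_relativeQuotient_mul_rpow_half hR₁,
    rpow_half_mul_relativeQuotient_mul_rpow_half hR₂, ← add_mul, ← mul_add, ← add_mul,
    ← mul_add] at key
  have := star_left_conjugate_le_conjugate key S
  rw [hSsa] at this
  refine this.trans_eq ?_
  set Z := a • (R₁ ^ (1 / 2 : ℝ) * cfc f (relativeQuotient L₁ R₁) * R₁ ^ (1 / 2 : ℝ)) +
    b • (R₂ ^ (1 / 2 : ℝ) * cfc f (relativeQuotient L₂ R₂) * R₂ ^ (1 / 2 : ℝ))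
  calc S * (S' * Z * S') * S = (S * S') * Z * (S' * S) := by simp only [mul_assoc]
    _ = Z := by rw [hSS', hS'S, one_mul, mul_one]

end

/-! ### Continuity of the perspective -/

section

lemma Set.OrdConnected.isLocallyClosed {J : Set ℝ} (hJ : J.OrdConnected) : IsLocallyClosed J := by
  have h := hJ.isPreconnected.mem_intervals
  simp only [Set.mem_insert_iff, Set.mem_singleton_iff] at h
  obtain h | h | h | h | h | h | h | h | h | h := h <;> rw [h]
  · exact isClosed_Icc.isLocallyClosed
  · exact isClosed_Ici.isLocallyClosed.inter isOpen_Iio.isLocallyClosed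
  · exact isOpen_Ioi.isLocallyClosed.inter isClosed_Iic.isLocallyClosed
  · exact isOpen_Ioo.isLocallyClosed
  · exact isClosed_Ici.isLocallyClosed
  · exact isOpen_Ioi.isLocallyClosed
  · exact isClosed_Iic.isLocallyClosed
  · exact isOpen_Iio.isLocallyClosed
  · exact isOpen_univ.isLocallyClosed
  · exact isOpen_empty.isLocallyClosed

/-- An interval is locally closed, so the spectra of all operators near `a` with spectrum in `J` lie in
one compact subset of `J`, even when `J` is not a neighbourhood of the spectrum of `a`. -/
lemma continuousOn_cfc_of_ordConnected {A : Type*} [CStarAlgebra A] {J : Set ℝ}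
    (hJ : J.OrdConnected) {f : ℝ → ℝ} (hf : ContinuousOn f J) :
    ContinuousOn (cfc f : A → A) {a | IsSelfAdjoint a ∧ spectrum ℝ a ⊆ J} := by
  obtain ⟨U, C, hU, hC, rfl⟩ := hJ.isLocallyClosed
  rintro a ⟨ha, haJ⟩
  obtain ⟨S, ⟨hS₁, hS₂⟩, hS₃⟩ :=
    (spectrum.isCompact (𝕜 := ℝ) a).nhdsSet_basis_isCompact.mem_iff.mp
      (hU.mem_nhdsSet.2 fun x hx => (haJ hx).1)
  have hev : ∀ᶠ b in 𝓝 a, spectrum ℝ b ⊆ S :=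
    ((upperHemicontinuous_spectrum ℝ A).upperHemicontinuousAt a _ hS₁).mono
      fun _ => subset_of_mem_nhdsSet
  refine ContinuousWithinAt.cfc (hS₂.inter_right hC) f ⟨ha, haJ⟩ continuousWithinAt_id ?_ ?_
    (hf.mono fun x hx => ⟨hS₃ hx.1, hx.2⟩)
  · filter_upwards [self_mem_nhdsWithin, mem_nhdsWithin_of_mem_nhds hev] with b hb hbS x hx
    exact ⟨hbS hx, (hb.2 hx).2⟩
  · filter_upwards [self_mem_nhdsWithin] with b hb using hb.1

variable {H : Type u} [NormedAddCommGroup H] [InnerProductSpace ℂ H] [CompleteSpace H]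

lemma continuousOn_rpow_isStrictlyPositive (s : ℝ) :
    ContinuousOn (fun R : H →L[ℂ] H => R ^ s) {R | IsStrictlyPositive R} := by
  have h : ContinuousOn (fun x : ℝ => x ^ s) (Set.Ioi 0) := fun x hx =>
    (Real.continuousAt_rpow_const x s (.inl hx.ne')).continuousWithinAt
  refine ((continuousOn_cfc_of_ordConnected Set.ordConnected_Ioi h).mono ?_).congr fun R hR => ?_
  · intro R hR
    exact ⟨hR.isSelfAdjoint, fun x hx => hR.spectrum_pos hx⟩
  · exact CFC.rpow_eq_cfc_real hR.nonneg

lemma continuousOn_operatorPerspective {J : Set ℝ} (hJ : J.OrdConnected) {f : ℝ → ℝ}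
    (hf : ContinuousOn f J) :
    ContinuousOn (fun p : (H →L[ℂ] H) × (H →L[ℂ] H) => operatorPerspective f p.1 p.2)
      (perspectiveDomain H J) := by
  have hpow (s : ℝ) : ContinuousOn (fun p : (H →L[ℂ] H) × (H →L[ℂ] H) => p.2 ^ s)
      (perspectiveDomain H J) :=
    (continuousOn_rpow_isStrictlyPositive s).comp continuousOn_snd fun p hp => hp.2.1
  have hq : ContinuousOn (fun p : (H →L[ℂ] H) × (H →L[ℂ] H) => relativeQuotient p.1 p.2)
      (perspectiveDomain H J) :=
    ((hpow _).mul continuousOn_fst).mul (hpow _)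
  exact ((hpow _).mul ((continuousOn_cfc_of_ordConnected hJ hf).comp hq fun p hp =>
    ⟨isSelfAdjoint_relativeQuotient hp.1, hp.2.2⟩)).mul (hpow _)

end

/-! ### Integrals of operator fields and Jensen's inequality -/

section
variable {H : Type u} [NormedAddCommGroup H] [InnerProductSpace ℂ H] [CompleteSpace H]
variable {T : Type v} [TopologicalSpace T] [MeasurableSpace T] [BorelSpace T]

omit [TopologicalSpace T] [BorelSpace T] in
lemma isSelfAdjoint_integral {μ : Measure T} {F : T → H →L[ℂ] H} (hF : ∀ t, IsSelfAdjoint (F t)) :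
    IsSelfAdjoint (∫ t, F t ∂μ) := by
  have := (starL' ℝ (A := H →L[ℂ] H)).integral_comp_comm F (μ := μ)
  simp only [starL'_apply, (hF _).star_eq] at this
  exact this.symm

/-- Continuity is used through the closed sets `{t | (n + 1)⁻¹ ≤ F t}`: they cover `T`, so that one of
them has positive measure. -/
lemma isStrictlyPositive_integral {μ : Measure T} [IsFiniteMeasure μ] (hμ : μ ≠ 0)
    {F : T → H →L[ℂ] H} (hF_cont : Continuous F) (hF_int : Integrable F μ)
    (hF : ∀ t, IsStrictlyPositive (F t)) : IsStrictlyPositive (∫ t, F t ∂μ) := by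
  let E : ℕ → Set T := fun n => {t | ((n : ℝ) + 1)⁻¹ • (1 : H →L[ℂ] H) ≤ F t}
  have hE : ∀ n, MeasurableSet (E n) := fun n =>
    (isClosed_le continuous_const hF_cont).measurableSet
  have hcover : ⋃ n, E n = Set.univ := by
    refine Set.eq_univ_of_forall fun t => Set.mem_iUnion.2 ?_
    obtain ⟨c, hc, hct⟩ := (hF t).exists_pos_smul_one_le
    obtain ⟨n, hn⟩ := exists_nat_one_div_lt hc
    rw [one_div] at hn
    exact ⟨n, (smul_le_smul_of_nonneg_right hn.le zero_le_one).trans hct⟩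
  obtain ⟨n, hn⟩ : ∃ n, μ (E n) ≠ 0 := by
    by_contra! h
    exact hμ (Measure.measure_univ_eq_zero.1 (hcover ▸ measure_iUnion_null h))
  have hpos : 0 < μ.real (E n) := ENNReal.toReal_pos hn (measure_ne_top μ _)
  refine isStrictlyPositive_of_smul_one_le (c := μ.real (E n) * ((n : ℝ) + 1)⁻¹)
    (by positivity) ?_
  rw [mul_smul, ← integral_indicator_const _ (hE n)]
  refine integral_mono ((integrable_const _).indicator (hE n)) hF_int fun t => ?_
  by_cases ht : t ∈ E n
  · rw [Set.indicator_of_mem ht]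
    exact ht
  · rw [Set.indicator_of_notMem ht]
    exact (hF t).nonneg

lemma integral_mem_perspectiveDomain {μ : Measure T} [IsFiniteMeasure μ] (hμ : μ ≠ 0)
    {J : Set ℝ} (hJ : J.OrdConnected) {A B : T → H →L[ℂ] H} (hA_cont : Continuous A)
    (hB_cont : Continuous B) (hA_int : Integrable A μ) (hB_int : Integrable B μ)
    (h : ∀ t, (A t, B t) ∈ perspectiveDomain H J) :
    (∫ t, A t ∂μ, ∫ t, B t ∂μ) ∈ perspectiveDomain H J := by
  have hA := isSelfAdjoint_integral (μ := μ) fun t => (h t).1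
  have hB := isStrictlyPositive_integral hμ hB_cont hB_int fun t => (h t).2.1
  have hspec := fun t => (spectrum_relativeQuotient_subset_iff hJ (h t).1 (h t).2.1).1 (h t).2.2
  have hxB : ∀ x : ℝ, Integrable (fun t => x • B t) μ := fun x => hB_int.smul x
  refine ⟨hA, hB, (spectrum_relativeQuotient_subset_iff hJ hA hB).2
    ⟨fun x hx => ?_, fun x hx => ?_⟩⟩
  · dsimp only
    rw [← integral_smul, ← integral_sub hA_int (hxB x)]
    exact isStrictlyPositive_integral hμ (hA_cont.sub (hB_cont.const_smul x))
      (hA_int.sub (hxB x)) fun t => (hspec t).1 x hx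
  · dsimp only
    rw [← integral_smul, ← integral_sub (hxB x) hA_int]
    exact isStrictlyPositive_integral hμ ((hB_cont.const_smul x).sub hA_cont)
      ((hxB x).sub hA_int) fun t => (hspec t).2 x hx

variable (H) in
/-- The epigraph of the perspective of `f`: the pairs `((L, R), Z)` with `g(L, R) ≤ Z`. -/
def perspectiveEpigraph (J : Set ℝ) (f : ℝ → ℝ) :
    Set (((H →L[ℂ] H) × (H →L[ℂ] H)) × (H →L[ℂ] H)) :=
  {p | p.1 ∈ perspectiveDomain H J ∧ operatorPerspective f p.1.1 p.1.2 ≤ p.2}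

lemma OperatorConvexOn.convex_perspectiveEpigraph {J : Set ℝ} {f : ℝ → ℝ}
    (hf : OperatorConvexOn.{u} J f) : Convex ℝ (perspectiveEpigraph H J f) := by
  rintro p ⟨hp, hpf⟩ q ⟨hq, hqf⟩ a b ha hb hab
  have hab' : 0 < a + b := hab ▸ one_pos
  refine ⟨smul_add_smul_mem_perspectiveDomain hf.ordConnected hp hq ha hb hab', ?_⟩
  exact (hf.operatorPerspective_smul_add_smul_le hp hq ha hb hab').trans
    (add_le_add (smul_le_smul_of_nonneg_left hpf ha) (smul_le_smul_of_nonneg_left hqf hb))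

/-- The epigraph is relatively closed over the domain of the perspective. -/
lemma OperatorConvexOn.operatorPerspective_le_of_mem_closure {J : Set ℝ} {f : ℝ → ℝ}
    (hf : OperatorConvexOn.{u} J f) {p : ((H →L[ℂ] H) × (H →L[ℂ] H)) × (H →L[ℂ] H)}
    (hp : p ∈ closure (perspectiveEpigraph H J f)) (hpd : p.1 ∈ perspectiveDomain H J) :
    operatorPerspective f p.1.1 p.1.2 ≤ p.2 := by
  have := mem_closure_iff_nhdsWithin_neBot.1 hp
  have h₁ : Tendsto (fun q : ((H →L[ℂ] H) × (H →L[ℂ] H)) × (H →L[ℂ] H) =>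
      operatorPerspective f q.1.1 q.1.2) (𝓝[perspectiveEpigraph H J f] p)
      (𝓝 (operatorPerspective f p.1.1 p.1.2)) :=
    ((continuousOn_operatorPerspective hf.ordConnected hf.continuousOn) p.1 hpd).tendsto.comp
      (tendsto_nhdsWithin_iff.2 ⟨continuousAt_fst.tendsto.mono_left nhdsWithin_le_nhds,
        eventually_nhdsWithin_of_forall fun q hq => hq.1⟩)
  have h₂ : Tendsto (fun q : ((H →L[ℂ] H) × (H →L[ℂ] H)) × (H →L[ℂ] H) => q.2)
      (𝓝[perspectiveEpigraph H J f] p) (𝓝 p.2) :=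
    continuousAt_snd.tendsto.mono_left nhdsWithin_le_nhds
  exact le_of_tendsto_of_tendsto h₁ h₂ (eventually_nhdsWithin_of_forall fun q hq => hq.2)

/-- By homogeneity of the perspective `g`, a positive multiple of `((L, R), Z)` in the closure of
the epigraph is enough for `g(L, R) ≤ Z`. -/
lemma OperatorConvexOn.operatorPerspective_le_of_smul_mem_closure {J : Set ℝ} {f : ℝ → ℝ}
    (hf : OperatorConvexOn.{u} J f) {L R Z : H →L[ℂ] H} (hLR : (L, R) ∈ perspectiveDomain H J)
    {c : ℝ} (hc : 0 < c) (h : ((c • L, c • R), c • Z) ∈ closure (perspectiveEpigraph H J f)) :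
    operatorPerspective f L R ≤ Z := by
  have hcLR : (c • L, c • R) ∈ perspectiveDomain H J := by
    have := smul_add_smul_mem_perspectiveDomain hf.ordConnected hLR hLR hc.le le_rfl
      (by rwa [add_zero])
    rwa [zero_smul, add_zero] at this
  have hle : operatorPerspective f (c • L) (c • R) ≤ c • Z :=
    hf.operatorPerspective_le_of_mem_closure h hcLR
  have hc' : 0 < c⁻¹ := inv_pos.2 hc
  have hhom := hf.operatorPerspective_smul_add_smul_le hcLR hcLR hc'.le le_rfl
    (by rwa [add_zero])
  simp only [zero_smul, add_zero, inv_smul_smul₀ hc.ne'] at hhom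
  have := hhom.trans (smul_le_smul_of_nonneg_left hle hc'.le)
  rwa [inv_smul_smul₀ hc.ne'] at this

omit [TopologicalSpace T] [BorelSpace T] in
/-- **Jensen's inequality for the perspective**. The mean of `t ↦ ((A t, B t), g(A t, B t))` lies in
the closure of the epigraph of the perspective `g`. -/
lemma OperatorConvexOn.operatorPerspective_integral_le {μ : Measure T} [IsFiniteMeasure μ]
    (hμ : μ ≠ 0) {J : Set ℝ} {f : ℝ → ℝ} (hf : OperatorConvexOn.{u} J f) {A B : T → H →L[ℂ] H}
    (hdom : ∀ t, (A t, B t) ∈ perspectiveDomain H J)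
    (hmem : (∫ t, A t ∂μ, ∫ t, B t ∂μ) ∈ perspectiveDomain H J)
    (hA_int : Integrable A μ) (hB_int : Integrable B μ)
    (hΘ_int : Integrable (fun t => operatorPerspective f (A t) (B t)) μ) :
    operatorPerspective f (∫ t, A t ∂μ) (∫ t, B t ∂μ) ≤
      ∫ t, operatorPerspective f (A t) (B t) ∂μ := by
  have : NeZero μ := ⟨hμ⟩
  have hm_pos : 0 < (μ.real Set.univ)⁻¹ :=
    inv_pos.2 (ENNReal.toReal_pos (by simpa using hμ) (measure_ne_top μ _))
  have hAB_int := hA_int.prodMk hB_int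
  have havg : (⨍ t, ((A t, B t), operatorPerspective f (A t) (B t)) ∂μ) ∈
      closure (perspectiveEpigraph H J f) :=
    (hf.convex_perspectiveEpigraph (H := H)).closure.average_mem isClosed_closure
      (ae_of_all _ fun t => subset_closure ⟨hdom t, le_rfl⟩) (hAB_int.prodMk hΘ_int)
  rw [average_eq, integral_pair hAB_int hΘ_int, integral_pair hA_int hB_int, Prod.smul_mk,
    Prod.smul_mk] at havg
  exact hf.operatorPerspective_le_of_smul_mem_closure hmem hm_pos havg

end

end

theorem theorem2p1
    {H : Type u} [NormedAddCommGroup H] [InnerProductSpace ℂ H] [CompleteSpace H]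
    {T : Type v} [TopologicalSpace T] [LocallyCompactSpace T] [T2Space T]
    [MeasurableSpace T] [BorelSpace T]
    (μ : Measure T) [IsFiniteMeasure μ] [μ.Regular] (hμ : μ ≠ 0)
    (J : Set ℝ) (f : ℝ → ℝ) (hf : OperatorConvexOn.{u} J f)
    (A B : T → H →L[ℂ] H)
    (hA_cont : Continuous A) (hB_cont : Continuous B)
    (hA_sa : ∀ t, IsSelfAdjoint (A t)) (hB_pos : ∀ t, IsStrictlyPositive (B t))
    (hspec : ∀ t, spectrum ℝ (relativeQuotient (A t) (B t)) ⊆ J)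
    (hA_int : Integrable A μ) (hB_int : Integrable B μ)
    (hΘ_int : Integrable (fun t => operatorPerspective f (A t) (B t)) μ) :
    -- the left-hand side is well defined
    IsSelfAdjoint (∫ t, A t ∂μ) ∧ IsStrictlyPositive (∫ t, B t ∂μ) ∧
    spectrum ℝ (relativeQuotient (∫ t, A t ∂μ) (∫ t, B t ∂μ)) ⊆ J ∧
    -- the inequality
    operatorPerspective f (∫ t, A t ∂μ) (∫ t, B t ∂μ) ≤ operatorDivergence μ f A B := by
  have hdom : ∀ t, (A t, B t) ∈ perspectiveDomain H J := fun t => ⟨hA_sa t, hB_pos t, hspec t⟩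
  have hmem := integral_mem_perspectiveDomain hμ hf.ordConnected hA_cont hB_cont hA_int hB_int hdom
  exact ⟨hmem.1, hmem.2.1, hmem.2.2,
    hf.operatorPerspective_integral_le hμ hdom hmem hA_int hB_int hΘ_int⟩
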